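/- **Theorem (Hartmann–Tzeng product bound).** Let $\mathbb E$ be a field and let $\mathbb F/\mathbb E$ and $\mathbb K/\mathbb E$ be finite extensions inside a common field, with $[\mathbb F:\mathbb E]=m$, $\mathbb F\cap\mathbb K=\mathbb E$ and $\mathbb L=\mathbb F\mathbb K$. Assume that $\mathbb L/\mathbb K$ is a cyclic Galois extension of degree $m$, and let $\sigma\in\mathrm{Gal}(\mathbb L/\mathbb K)$ restrict to an automorphism $\theta$ of $\mathbb F$ of order $m$ with fixed field $\mathbb F^\theta=\mathbb E$. Let $\ell\ge 1$ be an integer coprime to $m$, let $a\in\mathbb K$ be a primitive $\ell$-th root of unity, and let $\beta\in\mathbb L^*$ be a normal element of $\mathbb L/\mathbb K$ (its conjugates under $\mathrm{Gal}(\mathbb L/\mathbb K)$ form a $\mathbb K$-basis of $\mathbb L$). Let $\mathcal C_1\subseteq\mathbb F^\ell$ be a nonzero $\mathbb F$-linear cyclic code whose image under $u\mapsto\sum_i u_ix^i$ in $\mathbb F[x]/(x^\ell-1)$ is the ideal $(f_1)$ with $f_1\in\mathbb E[x]$, and let $d_H$ be its minimum Hamming distance. Let $\mathcal C_2\subseteq\mathbb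 F^m$ be a nonzero $\mathbb F$-linear skew-cyclic code, i.e. closed under $(v_0,\dots,v_{m-1})\mapsto(\theta(v_{m-1}),\theta(v_0),\dots,\theta(v_{m-2}))$, whose image under $v\mapsto\sum_j v_jz^j$ in $\mathbb F[z;\theta]/(z^m-1)$ is the left ideal $(f_2)$, where $zc=\theta(c)z$ for $c\in\mathbb F$. Let $d_R$ be its minimum rank distance for $\mathbb F/\mathbb E$, the rank weight of $v$ being $\dim_{\mathbb E}\langle v_0,\dots,v_{m-1}\rangle_{\mathbb E}$. Put $$T^H_{\mathcal C_1}=\{\alpha\in\mathbb L\mid \alpha^\ell=1,\ f_1(\alpha)=0\},\qquad T^R_{\mathcal C_2}=\{\gamma\in\mathbb L^*\mid f_2(\sigma(\gamma)\gamma^{-1})=0\},$$ where, for $f\in\mathbb L[z;\sigma]$ and $c\in\mathbb L$, $f(c)$ denotes the unique element of $\mathbb L$ with $f-f(c)\in\mathbb L[z;\sigma](z-c)$, and $$T^H_{\mathcal C_1}\uplus T^R_{\mathcal C_2}=\{(\alpha,\gamma)\in\mathbb L\times\mathbb L^*\mid \alpha\in T^H_{\mathcal C_1}\text{ or }\gamma\in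 T^R_{\mathcal C_2}\}.$$ Let $b,\delta,r,t_1,t_2$ be integers with $r\ge 0$, $\gcd(\ell m,t_1)=1$ and $\gcd(\ell m,t_2)<\delta$. If $$\{(a^{b+it_1+st_2},\ \sigma^{it_1+st_2}(\beta)) \mid 0\le i\le\delta-2,\ 0\le s\le r\}\subseteq T^H_{\mathcal C_1}\uplus T^R_{\mathcal C_2},$$ then $$d_H\ge\left\lceil\frac{\delta+r}{d_R}\right\rceil\qquad\text{and}\qquad d_R\ge\left\lceil\frac{\delta+r}{d_H}\right\rceil.$$ -/

import Mathlib

noncomputable section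

namespace HTProduct

/-! ### The Hamming metric and the rank metric -/

/-- `d` is the minimum Hamming distance of the linear code `C` of length `ℓ` over `F`, that is,
`d = min {d_H(u, v) | u, v ∈ C, u ≠ v}` (in particular the minimum exists, so `C ≠ 0`). -/
def IsMinHammingDist {F : Type*} [Field F] [DecidableEq F] {ℓ : ℕ}
    (C : Submodule F (Fin ℓ → F)) (d : ℕ) : Prop :=
  IsLeast {w : ℕ | ∃ u ∈ C, ∃ v ∈ C, u ≠ v ∧ hammingDist u v = w} d

/-- The rank weight of `v ∈ F ^ N` for the extension `F / E`: the `E`-dimension of the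
`E`-span of the coordinates of `v`. -/
def rankWeight (E : Type*) {F : Type*} [Field E] [Field F] [Algebra E F] {N : ℕ}
    (v : Fin N → F) : ℕ :=
  Module.finrank E (Submodule.span E (Set.range v))

/-- The rank distance for the extension `F / E`. -/
def rankDist (E : Type*) {F : Type*} [Field E] [Field F] [Algebra E F] {N : ℕ}
    (u v : Fin N → F) : ℕ :=
  rankWeight E (u - v)

/-- `d` is the minimum rank distance (for `F / E`) of the `F`-linear code `C` of length `N`, that
is, `d = min {d_R(u, v) | u, v ∈ C, u ≠ v}` (in particular the minimum exists, so `C ≠ 0`). -/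
def IsMinRankDist (E : Type*) {F : Type*} [Field E] [Field F] [Algebra E F] {N : ℕ}
    (C : Submodule F (Fin N → F)) (d : ℕ) : Prop :=
  IsLeast {w : ℕ | ∃ u ∈ C, ∃ v ∈ C, u ≠ v ∧ rankDist E u v = w} d

/-! ### Skew polynomial rings -/

/-- A copy of the ring `R`, on which `Multiplicative ℕ` acts through the powers of the
endomorphism `σ`. It is the coefficient ring of `R[z; σ]`. -/
def Twist {R : Type*} [CommRing R] (_σ : R →+* R) : Type _ := R

section Skew

variable {R : Type*} [CommRing R] (σ : R →+* R)

instance : CommRing (Twist σ) := inferInstanceAs (CommRing R)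

/-- The identity map from `R` to its copy `Twist σ`. -/
def Twist.of : R ≃+* Twist σ := RingEquiv.refl R

instance : MulSemiringAction (Multiplicative ℕ) (Twist σ) :=
  MulSemiringAction.compHom R (powersHom (R →+* R) σ)

/-- The skew polynomial ring `R[z; σ]`, with `z * a = σ a * z`. -/
abbrev SkewPoly : Type _ := SkewPolynomial (Twist σ)

variable {σ}

theorem phi_of (a : R) :
    SkewPolynomial.φ (Twist.of σ a) = Twist.of σ (σ a) := by
  change (powersHom (R →+* R) σ (Multiplicative.ofAdd 1)) a = σ a
  simp

/-- The commutation rule `z * a = σ a * z`. -/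
theorem X_mul_C (a : R) :
    (SkewPolynomial.X : SkewPoly σ) * SkewPolynomial.C (Twist.of σ a) =
      SkewPolynomial.C (Twist.of σ (σ a)) * SkewPolynomial.X := by
  rw [← SkewPolynomial.monomial_zero_left, ← SkewPolynomial.monomial_zero_left,
    SkewPolynomial.X_mul_monomial, SkewPolynomial.monomial_mul_X, phi_of]

/-- `c` is the remainder of `f` on right division by `z - a`, that is,
`f = q (z - a) + c` for some `q` in `R[z; σ]`. -/
def IsSkewEval (f : SkewPoly σ) (a c : R) : Prop :=
  ∃ q : SkewPoly σ,
    f = q * (SkewPolynomial.X - SkewPolynomial.C (Twist.of σ a)) +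
      SkewPolynomial.C (Twist.of σ c)

/-- The coefficients of the remainder formula: `N_0 = 1`, `N_{n+1} = N_n * σ^n(a)`. -/
def skewNorm (σ : R →+* R) (a : R) : ℕ → R
  | 0 => 1
  | n + 1 => skewNorm σ a n * σ^[n] a

theorem phi_iterate_of (n : ℕ) (a : R) :
    (SkewPolynomial.φ (R := Twist σ))^[n] (Twist.of σ a) = Twist.of σ (σ^[n] a) := by
  induction n generalizing a with
  | zero => rfl
  | succ n ih => rw [Function.iterate_succ_apply, phi_of, ih, Function.iterate_succ_apply]

/-- The additive map `∑ c_n z ^ n ↦ ∑ c_n N_n`. -/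
def skewRemainder (a : R) : SkewPoly σ →+ R where
  toFun f := f.sum fun n c => (Twist.of σ).symm c * skewNorm σ a n
  map_zero' := SkewMonoidAlgebra.sum_zero_index
  map_add' f g := by
    simp only [SkewPolynomial.sum_def']
    exact SkewMonoidAlgebra.sum_add_index' (fun _ => by simp) (fun _ _ _ => by simp [add_mul])

theorem skewRemainder_monomial (a : R) (n : ℕ) (c : Twist σ) :
    skewRemainder a (SkewPolynomial.monomial n c : SkewPoly σ) =
      (Twist.of σ).symm c * skewNorm σ a n :=
  SkewPolynomial.sum_monomial_index
    (h := fun n (c : Twist σ) => (Twist.of σ).symm c * skewNorm σ a n) (by simp)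

theorem skewRemainder_mul (a : R) (q : SkewPoly σ) :
    skewRemainder a (q * (SkewPolynomial.X - SkewPolynomial.C (Twist.of σ a))) = 0 := by
  induction q using SkewPolynomial.induction with
  | h0 => simp
  | ha n c q _ _ ih =>
    rw [add_mul, map_add, ih, add_zero, mul_sub, SkewPolynomial.monomial_mul_X,
      SkewPolynomial.monomial_mul_C, phi_iterate_of, map_sub, skewRemainder_monomial,
      skewRemainder_monomial, map_mul, RingEquiv.symm_apply_apply, skewNorm]
    ring

theorem isSkewEval_monomial (a : R) (n : ℕ) (c : Twist σ) :
    IsSkewEval (SkewPolynomial.monomial n c : SkewPoly σ) a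
      ((Twist.of σ).symm c * skewNorm σ a n) := by
  induction n generalizing c with
  | zero => exact ⟨0, by simp [skewNorm]⟩
  | succ n ih =>
    obtain ⟨q, hq⟩ := ih (c * Twist.of σ (σ^[n] a))
    refine ⟨SkewPolynomial.monomial n c + q, ?_⟩
    have h : (Twist.of σ).symm (c * Twist.of σ (σ^[n] a)) * skewNorm σ a n =
        (Twist.of σ).symm c * skewNorm σ a (n + 1) := by
      rw [map_mul, RingEquiv.symm_apply_apply, skewNorm]; ring
    rw [h] at hq
    rw [add_mul, add_assoc, ← hq, mul_sub, SkewPolynomial.monomial_mul_X,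
      SkewPolynomial.monomial_mul_C, phi_iterate_of, sub_add_cancel]

/-- Right division by `z - a` is possible with a unique constant remainder. -/
theorem existsUnique_isSkewEval (f : SkewPoly σ) (a : R) : ∃! c : R, IsSkewEval f a c := by
  refine ⟨skewRemainder a f, ?_, ?_⟩
  · induction f using SkewPolynomial.induction with
    | h0 => exact ⟨0, by simp⟩
    | ha n c f _ _ ih =>
      obtain ⟨q, hq⟩ := ih
      obtain ⟨p, hp⟩ := isSkewEval_monomial a n c
      refine ⟨p + q, ?_⟩
      rw [map_add, skewRemainder_monomial, map_add, map_add, add_mul]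
      nth_rewrite 1 [hp, hq]
      abel
  · rintro c ⟨q, rfl⟩
    rw [map_add, skewRemainder_mul, zero_add, ← SkewPolynomial.monomial_zero_left,
      skewRemainder_monomial]
    simp [skewNorm]

/-- The evaluation `f(a)` of a skew polynomial `f ∈ R[z; σ]` at `a`: the unique `c` with
`f = q (z - a) + c` for some `q`. -/
def skewEval (f : SkewPoly σ) (a : R) : R := (existsUnique_isSkewEval f a).choose

/-- The map `R[z; θ] → R'[z; σ]` that applies `ι : R → R'` to the coefficients. -/
def mapSkew {R' : Type*} [CommRing R'] (ι : R →+* R') {θ : R →+* R} (σ : R' →+* R')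
    (f : SkewPoly θ) : SkewPoly σ :=
  f.sum fun i c => SkewPolynomial.monomial i (Twist.of σ (ι ((Twist.of θ).symm c)))

end Skew

/-! ### Cyclic codes -/

/-- `C` is closed under `(u_0, …, u_{ℓ-1}) ↦ (u_{ℓ-1}, u_0, …, u_{ℓ-2})`. -/
def IsCyclicCode {F : Type*} [Field F] {ℓ : ℕ} (C : Submodule F (Fin ℓ → F)) : Prop :=
  ∀ u ∈ C, u ∘ (finRotate ℓ).symm ∈ C

/-- The ring `F[x] / (x ^ ℓ - 1)`. -/
abbrev CyclicRing (F : Type*) [Field F] (ℓ : ℕ) : Type _ :=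
  Polynomial F ⧸ Ideal.span {(Polynomial.X ^ ℓ - 1 : Polynomial F)}

/-- The map `(u_0, …, u_{ℓ-1}) ↦ ∑ u_i x ^ i` from `F ^ ℓ` to `F[x] / (x ^ ℓ - 1)`. -/
def muH {F : Type*} [Field F] {ℓ : ℕ} (u : Fin ℓ → F) : CyclicRing F ℓ :=
  Ideal.Quotient.mk _ (∑ i : Fin ℓ, Polynomial.monomial (i : ℕ) (u i))

/-- `f₁ ∈ F[x]` generates the code `C`: the image of `C` in `F[x] / (x ^ ℓ - 1)` is the
ideal `(f₁)`. -/
def IsCyclicGenerator {F : Type*} [Field F] {ℓ : ℕ} (C : Submodule F (Fin ℓ → F))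
    (f₁ : Polynomial F) : Prop :=
  muH '' (C : Set (Fin ℓ → F)) =
    (Ideal.span {(Ideal.Quotient.mk _ f₁ : CyclicRing F ℓ)} : Set (CyclicRing F ℓ))

/-- The defining set `{a ∈ L | a ^ ℓ = 1, f₁(a) = 0}` of the cyclic code of length `ℓ`
generated by `f₁`. -/
def cyclicDefiningSet {F : Type*} [Field F] (L : Type*) [Field L] [Algebra F L] (ℓ : ℕ)
    (f₁ : Polynomial F) : Set L :=
  {a : L | a ^ ℓ = 1 ∧ Polynomial.aeval a f₁ = 0}

/-! ### Skew-cyclic codes -/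

/-- `C` is closed under
`(v_0, …, v_{N-1}) ↦ (θ v_{N-1}, θ v_0, …, θ v_{N-2})`. -/
def IsSkewCyclicCode {F : Type*} [Field F] (θ : F →+* F) {N : ℕ}
    (C : Submodule F (Fin N → F)) : Prop :=
  ∀ v ∈ C, (θ ∘ v ∘ (finRotate N).symm) ∈ C

/-- The ring `F[z; θ] / (z ^ N - 1)`, the quotient by the two-sided ideal generated by
`z ^ N - 1`. -/
abbrev SkewCyclicRing {F : Type*} [Field F] (θ : F →+* F) (N : ℕ) : Type _ :=
  (TwoSidedIdeal.span {(SkewPolynomial.X ^ N - 1 : SkewPoly θ)}).ringCon.Quotient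

/-- The quotient map `F[z; θ] → F[z; θ] / (z ^ N - 1)`. -/
def SkewCyclicRing.mk {F : Type*} [Field F] (θ : F →+* F) (N : ℕ) :
    SkewPoly θ →+* SkewCyclicRing θ N :=
  (TwoSidedIdeal.span {(SkewPolynomial.X ^ N - 1 : SkewPoly θ)}).ringCon.mk'

/-- The map `(v_0, …, v_{N-1}) ↦ ∑ v_j z ^ j` from `F ^ N` to `F[z; θ] / (z ^ N - 1)`. -/
def nuR {F : Type*} [Field F] (θ : F →+* F) {N : ℕ} (v : Fin N → F) : SkewCyclicRing θ N :=
  SkewCyclicRing.mk θ N (∑ j : Fin N, SkewPolynomial.monomial (j : ℕ) (Twist.of θ (v j)))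

/-- `f₂ ∈ F[z; θ]` generates the code `C`: the image of `C` in `F[z; θ] / (z ^ N - 1)` is the
left ideal `(f₂)`. (`Ideal` is Mathlib's notion of a left ideal.) -/
def IsSkewCyclicGenerator {F : Type*} [Field F] (θ : F →+* F) {N : ℕ}
    (C : Submodule F (Fin N → F)) (f₂ : SkewPoly θ) : Prop :=
  nuR θ '' (C : Set (Fin N → F)) =
    (Ideal.span {SkewCyclicRing.mk θ N f₂} : Set (SkewCyclicRing θ N))

/-- The defining set `{β ∈ L* | f₂(σ(β) β⁻¹) = 0}` of the skew-cyclic code generated by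
`f₂ ∈ F[z; θ]`, where `f₂` is evaluated as an element of `L[z; σ]`. -/
def skewCyclicDefiningSet {F L : Type*} [Field F] [Field L] [Algebra F L]
    {θ : F →+* F} (σ : L →+* L) (f₂ : SkewPoly θ) : Set Lˣ :=
  {β : Lˣ | skewEval (mapSkew (algebraMap F L) σ f₂) (σ (β : L) * (β : L)⁻¹) = 0}

/-! ### Normal elements and the operation `⊎` -/

/-- `β` is a normal element of `L / K`: its conjugates under `Gal(L / K)` form a `K`-basis
of `L`. -/
def IsNormalElement (K : Type*) {L : Type*} [Field K] [Field L] [Algebra K L] (β : L) : Prop :=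
  LinearIndependent K (fun τ : L ≃ₐ[K] L => τ β) ∧
    Submodule.span K (Set.range fun τ : L ≃ₐ[K] L => τ β) = ⊤

/-- `A ⊎ B = {(x, y) ∈ X × Y | x ∈ A or y ∈ B}`. -/
def uplus {X Y : Type*} (A : Set X) (B : Set Y) : Set (X × Y) :=
  {p | p.1 ∈ A ∨ p.2 ∈ B}

end HTProduct

end

/-! Let `u` and `v` be nonzero codewords of Hamming weight h and rank weight w; it suffices that δ +
r ≤ h·w. For each exponent n = i t₁ + s t₂ of the hypothesis, the product of ∑ u_i a^{(b+n)i} and ∑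
v_j σ^{n+j}(β) is zero, because one factor is. Factor v = xA through its rank
(`exists_rank_factorization`) and put y_k = ∑ A_kj σ^j(β), which are independent over K. The product
becomes a nontrivial linear form in φ(n) = (a^{in} σ^n(y_k)), a vector of L^{h·w} indexed by the
support of u and the w indices k. So these φ(n) span a proper subspace.

On the other hand, a semilinear bijection takes φ(n) to φ(n + t). Hence adjoining a translate by t
enlarges a span unless the span is already shift-invariant, and then it contains every φ(n). All
φ(n) together span L^{h·w} (`span_range_twistedSequence`: Chinese remainders, Vandermonde, trace
form). Starting from dimension 1, the steps t₁ yield δ - 1 and the steps t₂ a further r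
(`min_le_finrank_span_hartmannTzeng`), so a proper span forces δ - 1 + r < h·w. -/

namespace HTProduct

/-! ### Growth of spans along arithmetic progressions -/

section SpanGrowth

variable {L V : Type*} [Field L] [AddCommGroup V] [Module L V]

/-- The translates `a + s t` of the elements of `A` with `0 ≤ s ≤ r`. -/
def progression (A : Set ℤ) (t : ℤ) (r : ℕ) : Set ℤ :=
  {n | ∃ a ∈ A, ∃ s : ℕ, s ≤ r ∧ n = a + s * t}

theorem progression_zero (A : Set ℤ) (t : ℤ) : progression A t 0 = A := by
  ext n
  constructor
  · rintro ⟨a, ha, s, hs, rfl⟩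
    obtain rfl : s = 0 := by omega
    simpa using ha
  · exact fun hn => ⟨n, hn, 0, le_rfl, by simp⟩

theorem progression_subset (A : Set ℤ) (t : ℤ) (r : ℕ) : A ⊆ progression A t r :=
  fun n hn => ⟨n, hn, 0, Nat.zero_le _, by simp⟩

theorem progression_mono (A : Set ℤ) (t : ℤ) {r r' : ℕ} (h : r ≤ r') :
    progression A t r ⊆ progression A t r' := by
  rintro n ⟨a, ha, s, hs, rfl⟩
  exact ⟨a, ha, s, hs.trans h, rfl⟩

theorem add_mem_progression {A : Set ℤ} {t : ℤ} {r : ℕ} {n : ℤ} (hn : n ∈ progression A t r) :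
    n + t ∈ progression A t (r + 1) := by
  obtain ⟨a, ha, s, hs, rfl⟩ := hn
  exact ⟨a, ha, s + 1, by omega, by push_cast; ring⟩

/-- The translates by `t` of linear dependences among the values of `φ` are again linear
dependences, possibly with other coefficients. -/
def IsShiftStable (L : Type*) {V : Type*} [Field L] [AddCommGroup V] [Module L V]
    (φ : ℤ → V) : Prop :=
  ∀ (A : Set ℤ) (n t : ℤ), φ n ∈ Submodule.span L (φ '' A) →
    φ (n + t) ∈ Submodule.span L (φ '' ((· + t) '' A))

/-- A span that absorbs one shift by `t` absorbs all forward shifts by induction, and by `hcov`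
these already reach every value of `φ`. -/
theorem span_eq_top_of_shift {φ : ℤ → V} (hφ : IsShiftStable L φ)
    (htop : Submodule.span L (Set.range φ) = ⊤) {A : Set ℤ} {t : ℤ}
    (hcov : ∀ n : ℤ, ∃ a ∈ A, ∃ k : ℕ, φ n = φ (a + k * t))
    (hA : ∀ a ∈ A, φ (a + t) ∈ Submodule.span L (φ '' A)) :
    Submodule.span L (φ '' A) = ⊤ := by
  have key : ∀ (k : ℕ), ∀ a ∈ A, φ (a + k * t) ∈ Submodule.span L (φ '' A) := by
    intro k
    induction k with
    | zero => intro a ha; exact Submodule.subset_span ⟨a, ha, by simp⟩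
    | succ k ih =>
      intro a ha
      have h := hφ A (a + k * t) t (ih a ha)
      rw [show a + ((k + 1 : ℕ) : ℤ) * t = a + k * t + t by push_cast; ring]
      refine Submodule.span_le.2 ?_ h
      rintro _ ⟨_, ⟨c, hc, rfl⟩, rfl⟩
      exact hA c hc
  rw [eq_top_iff, ← htop, Submodule.span_le]
  rintro _ ⟨n, rfl⟩
  obtain ⟨a, ha, k, h⟩ := hcov n
  rw [h]
  exact key k a ha

/-- The dimension of the span grows with each translate until it is maximal. -/
theorem min_le_finrank_span_progression [FiniteDimensional L V] {φ : ℤ → V}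
    (hφ : IsShiftStable L φ) (htop : Submodule.span L (Set.range φ) = ⊤) {A : Set ℤ} {t : ℤ}
    (hcov : ∀ n : ℤ, ∃ a ∈ A, ∃ k : ℕ, φ n = φ (a + k * t)) (r : ℕ) :
    min (Module.finrank L V) (Module.finrank L (Submodule.span L (φ '' A)) + r) ≤
      Module.finrank L (Submodule.span L (φ '' progression A t r)) := by
  induction r with
  | zero => rw [progression_zero]; exact min_le_right _ _
  | succ r ih =>
    by_cases h : Submodule.span L (φ '' progression A t r) = ⊤
    · have h' : Submodule.span L (φ '' progression A t (r + 1)) = ⊤ :=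
        top_le_iff.1 (h ▸ Submodule.span_mono
          (Set.image_mono (progression_mono A t (Nat.le_succ r))))
      rw [h', finrank_top]
      exact min_le_left _ _
    -- If the span did not grow, it would absorb its own translate by `t`, hence be everything.
    · have hlt : Submodule.span L (φ '' progression A t r) <
          Submodule.span L (φ '' progression A t (r + 1)) := by
        refine lt_of_le_of_ne (Submodule.span_mono
          (Set.image_mono (progression_mono A t (Nat.le_succ r)))) fun heq => h ?_
        refine span_eq_top_of_shift (t := t) hφ htop (fun n => ?_) fun a ha => ?_
        · obtain ⟨a, ha, k, hk⟩ := hcov n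
          exact ⟨a, progression_subset A t r ha, k, hk⟩
        · rw [heq]
          exact Submodule.subset_span ⟨_, add_mem_progression ha, rfl⟩
      have := Submodule.finrank_lt_finrank_of_lt hlt
      omega

/-- Every residue class modulo `N` contains some `i t₁ + k t₂` with `0 ≤ i < gcd(N, t₂)`. -/
theorem exists_modEq_progression {N : ℕ} (hN : 0 < N) {t₁ t₂ : ℤ} (ht₁ : Int.gcd (N : ℤ) t₁ = 1)
    (n : ℤ) : ∃ i : ℕ, i < Int.gcd (N : ℤ) t₂ ∧ ∃ k : ℕ, (N : ℤ) ∣ i * t₁ + k * t₂ - n := by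
  have hN' : (0 : ℤ) < N := by exact_mod_cast hN
  obtain ⟨g, hg⟩ : ∃ g : ℕ, g = Int.gcd (N : ℤ) t₂ := ⟨_, rfl⟩
  have hg0 : 0 < g := hg ▸ Int.gcd_pos_of_ne_zero_left _ hN'.ne'
  have hgN : (g : ℤ) ∣ N := hg ▸ Int.gcd_dvd_left ..
  have hb₁ := Int.gcd_eq_gcd_ab (N : ℤ) t₁
  rw [ht₁] at hb₁
  have hb₂ := Int.gcd_eq_gcd_ab (N : ℤ) t₂
  rw [← hg] at hb₂
  set x := Int.gcdA (N : ℤ) t₁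
  set y := Int.gcdB (N : ℤ) t₁
  have hg0' : (0 : ℤ) < g := by exact_mod_cast hg0
  -- Since `y` inverts `t₁` modulo `N`, taking i ≡ ny modulo `g` makes n - i t₁ divisible by `g`,
  -- hence a multiple of `t₂` modulo `N`.
  obtain ⟨i, hi⟩ := Int.eq_ofNat_of_zero_le (Int.emod_nonneg (n * y) hg0'.ne')
  have hig : i < g := by
    have := Int.emod_lt_of_pos (n * y) hg0'
    omega
  obtain ⟨c, hc⟩ := hgN
  have hdiv := Int.emod_add_mul_ediv (n * y) g
  rw [hi] at hdiv
  have hq : n - i * t₁ = g * (c * x * n + n * y / g * t₁) := by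
    have : n = n * (N * x + t₁ * y) := by rw [← hb₁]; simp
    have h2 : (i : ℤ) = n * y - g * (n * y / g) := by linarith
    rw [h2]
    nth_rewrite 1 [this]
    rw [hc]
    ring
  set q := c * x * n + n * y / g * t₁
  set z := Int.gcdB (N : ℤ) t₂
  obtain ⟨k, hk⟩ := Int.eq_ofNat_of_zero_le (Int.emod_nonneg (q * z) hN'.ne')
  refine ⟨i, hg ▸ hig, k, ?_⟩
  have hdiv' := Int.emod_add_mul_ediv (q * z) N
  rw [hk] at hdiv'
  refine ⟨-(q * z / N) * t₂ - q * Int.gcdA (N : ℤ) t₂, ?_⟩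
  have h3 : (k : ℤ) = q * z - N * (q * z / N) := by linarith
  rw [h3]
  have h4 : (i : ℤ) * t₁ - n = - (g * q) := by linarith
  calc _ = (i * t₁ - n) + (q * z - N * (q * z / N)) * t₂ := by ring
    _ = _ := by rw [h4, hb₂]; ring

/-- The Hartmann–Tzeng rank bound for a sequence of period `N` with shift-stable dependences. -/
theorem min_le_finrank_span_hartmannTzeng [FiniteDimensional L V] {φ : ℤ → V}
    (hφ : IsShiftStable L φ) (htop : Submodule.span L (Set.range φ) = ⊤) {N : ℕ} (hN : 0 < N)
    (hper : ∀ n n' : ℤ, (N : ℤ) ∣ n' - n → φ n = φ n') {t₁ t₂ : ℤ} {d r : ℕ}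
    (ht₁ : Int.gcd (N : ℤ) t₁ = 1) (ht₂ : Int.gcd (N : ℤ) t₂ < d + 2) :
    min (Module.finrank L V) (d + 1 + r) ≤
      Module.finrank L (Submodule.span L (φ '' progression (progression {0} t₁ d) t₂ r)) := by
  -- With `t₂ := t₁` the gcd is 1, so the multiples of `t₁` alone cover all residues.
  have h₁ := min_le_finrank_span_progression hφ htop (A := {0}) (t := t₁) (fun n => by
    obtain ⟨i, hi, k, hk⟩ := exists_modEq_progression hN (t₂ := t₁) ht₁ n
    obtain rfl : i = 0 := by omega
    exact ⟨0, rfl, k, hper _ _ (by simpa using hk)⟩) d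
  have h₂ := min_le_finrank_span_progression hφ htop (A := progression {0} t₁ d) (t := t₂)
    (fun n => by
      obtain ⟨i, hi, k, hk⟩ := exists_modEq_progression hN (t₂ := t₂) ht₁ n
      -- Here i < gcd(N, t₂) < d + 2 gives i ≤ d: this is where the bound on the gcd enters.
      exact ⟨i * t₁, ⟨0, rfl, i, by omega, by simp⟩, k, hper _ _ hk⟩) r
  rcases Nat.eq_zero_or_pos (Module.finrank L V) with h0 | h0
  · simp [h0]
  -- Shift stability with the empty set propagates a zero value to the whole sequence.
  have hφ0 : φ 0 ≠ 0 := by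
    intro h
    have hz : ∀ n, φ n = 0 := fun n => by
      have := hφ ∅ 0 n (by simp [h])
      simpa using this
    have : (⊤ : Submodule L V) = ⊥ := by
      rw [← htop, Submodule.span_eq_bot]
      rintro _ ⟨n, rfl⟩
      exact hz n
    rw [← finrank_top L V, this, finrank_bot] at h0
    exact lt_irrefl _ h0
  rw [Set.image_singleton, finrank_span_singleton hφ0] at h₁
  omega

end SpanGrowth

end HTProduct

namespace HTProduct
noncomputable section

/-! ### Vanishing of codewords at the defining sets -/

section SkewOperator

variable {F L : Type*} [Field F] [Field L] [Algebra F L]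

theorem algebraMap_iterate {θ : F →+* F} {σ : L →+* L}
    (hθ : ∀ x : F, algebraMap F L (θ x) = σ (algebraMap F L x)) (n : ℕ) (x : F) :
    algebraMap F L (θ^[n] x) = σ^[n] (algebraMap F L x) := by
  induction n generalizing x with
  | zero => rfl
  | succ n ih => rw [Function.iterate_succ_apply, ih, hθ, Function.iterate_succ_apply]

theorem powersHom_ofAdd_apply (σ : L →+* L) (n : ℕ) (γ : L) :
    powersHom (AddMonoid.End L) (σ : L →+ L) (Multiplicative.ofAdd n) γ = σ^[n] γ :=
  congrFun (AddMonoid.End.coe_pow _ (σ : L →+ L) n) γ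

/-- The additive endomorphism `∑ c_j σ ^ j` of `L` attached to `∑ c_j z ^ j`. -/
def skewOperator {θ : F →+* F} (σ : L →+* L)
    (hθ : ∀ x : F, algebraMap F L (θ x) = σ (algebraMap F L x)) :
    SkewPoly θ →+* AddMonoid.End L :=
  SkewMonoidAlgebra.liftNCRingHom
    ((Module.toAddMonoidEnd L L).comp ((algebraMap F L).comp ((Twist.of θ).symm : Twist θ →+* F)))
    (powersHom (AddMonoid.End L) (σ : L →+ L))
    (by
      intro x y
      ext γ
      obtain ⟨n, rfl⟩ := Multiplicative.ofAdd.surjective y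
      have h : (Twist.of θ).symm (Multiplicative.ofAdd n • x) = θ^[n] ((Twist.of θ).symm x) := by
        rw [← SkewPolynomial.φ_iterate_apply]
        obtain ⟨x, rfl⟩ := (Twist.of θ).surjective x
        rw [phi_iterate_of, RingEquiv.symm_apply_apply, RingEquiv.symm_apply_apply]
      change algebraMap F L ((Twist.of θ).symm (Multiplicative.ofAdd n • x)) *
          powersHom (AddMonoid.End L) (σ : L →+ L) (Multiplicative.ofAdd n) γ =
        powersHom (AddMonoid.End L) (σ : L →+ L) (Multiplicative.ofAdd n)
          (algebraMap F L ((Twist.of θ).symm x) * γ)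
      rw [powersHom_ofAdd_apply, powersHom_ofAdd_apply, h, algebraMap_iterate hθ,
        iterate_map_mul])

theorem skewOperator_monomial {θ : F →+* F} (σ : L →+* L)
    (hθ : ∀ x : F, algebraMap F L (θ x) = σ (algebraMap F L x)) (n : ℕ) (c : Twist θ) (γ : L) :
    skewOperator σ hθ (SkewPolynomial.monomial n c) γ =
      algebraMap F L ((Twist.of θ).symm c) * σ^[n] γ := by
  rw [← powersHom_ofAdd_apply]
  exact DFunLike.congr_fun (SkewMonoidAlgebra.liftNC_single (G := Multiplicative ℕ) _ _ _ _) γ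

theorem skewOperator_sum {θ : F →+* F} (σ : L →+* L)
    (hθ : ∀ x : F, algebraMap F L (θ x) = σ (algebraMap F L x)) {ι : Type*} (s : Finset ι)
    (f : ι → SkewPoly θ) (γ : L) :
    skewOperator σ hθ (∑ i ∈ s, f i) γ = ∑ i ∈ s, skewOperator σ hθ (f i) γ := by
  rw [map_sum]
  exact AddMonoidHom.finsetSum_apply _ s γ

theorem skewEval_eq_skewRemainder {R : Type*} [CommRing R] {σ : R →+* R} (f : SkewPoly σ)
    (a : R) : skewEval f a = skewRemainder a f := by
  obtain ⟨q, hq⟩ := (existsUnique_isSkewEval f a).choose_spec.1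
  change f = q * _ + SkewPolynomial.C (Twist.of σ (skewEval f a)) at hq
  conv_rhs => rw [hq]
  rw [map_add, skewRemainder_mul, zero_add, ← SkewPolynomial.monomial_zero_left,
    skewRemainder_monomial]
  simp [skewNorm]

/-- The product of the σ^i(σ(γ)/γ) for i < n telescopes. -/
theorem skewNorm_mul_inv_mul (σ : L →+* L) (γ : Lˣ) (n : ℕ) :
    skewNorm σ (σ γ * (γ : L)⁻¹) n * γ = σ^[n] γ := by
  induction n with
  | zero => simp [skewNorm]
  | succ n ih =>
    have h : σ^[n] (γ : L) ≠ 0 := by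
      rw [← RingHom.coe_pow]
      exact (map_ne_zero _).2 γ.ne_zero
    rw [skewNorm, mul_right_comm, ih, iterate_map_mul, ← Function.iterate_succ_apply,
      mul_comm (σ^[n + 1] _), ← mul_assoc, ← iterate_map_mul, mul_inv_cancel₀ γ.ne_zero,
      iterate_map_one, one_mul]

/-- Trades the remainder, which is not multiplicative in `f`, for the action of f(σ) on `γ`, where
products become compositions. -/
theorem skewEval_mapSkew_mul {θ : F →+* F} (σ : L →+* L)
    (hθ : ∀ x : F, algebraMap F L (θ x) = σ (algebraMap F L x)) (f : SkewPoly θ) (γ : Lˣ) :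
    skewEval (mapSkew (algebraMap F L) σ f) (σ γ * (γ : L)⁻¹) * γ = skewOperator σ hθ f γ := by
  rw [skewEval_eq_skewRemainder, mapSkew]
  conv_rhs => rw [← SkewPolynomial.sum_monomial f]
  simp only [SkewPolynomial.sum_def, map_sum (skewRemainder _), skewOperator_sum, Finset.sum_mul,
    skewRemainder_monomial, skewOperator_monomial, RingEquiv.symm_apply_apply, mul_assoc,
    skewNorm_mul_inv_mul]

/-- The polynomial of `v` is a left multiple of `f` modulo z^N - 1. Its operator kills `γ` because
f(σ) does and σ^N - 1 = 0. -/
theorem sum_mul_iterate_eq_zero {θ : F →+* F} {σ : L →+* L}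
    (hθ : ∀ x : F, algebraMap F L (θ x) = σ (algebraMap F L x)) {N : ℕ} (hσ : ∀ x, σ^[N] x = x)
    {C : Submodule F (Fin N → F)} {f : SkewPoly θ} (hf : IsSkewCyclicGenerator θ C f)
    {v : Fin N → F} (hv : v ∈ C) {γ : Lˣ} (hγ : γ ∈ skewCyclicDefiningSet σ f) :
    ∑ j, algebraMap F L (v j) * σ^[j] (γ : L) = 0 := by
  have hmem : nuR θ v ∈ Ideal.span {SkewCyclicRing.mk θ N f} :=
    hf.subset ⟨v, hv, rfl⟩
  obtain ⟨q, hq⟩ := Ideal.mem_span_singleton'.1 hmem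
  obtain ⟨q, rfl⟩ := RingCon.mk'_surjective _ q
  change SkewCyclicRing.mk θ N q * SkewCyclicRing.mk θ N f = _ at hq
  rw [← map_mul] at hq
  have hrel := (RingCon.eq _).1 hq
  have hker : TwoSidedIdeal.span {(SkewPolynomial.X ^ N - 1 : SkewPoly θ)} ≤
      TwoSidedIdeal.ker (skewOperator σ hθ) := by
    rw [TwoSidedIdeal.span_le, Set.singleton_subset_iff, SetLike.mem_coe, TwoSidedIdeal.mem_ker]
    ext x
    rw [map_sub, map_one, ← SkewPolynomial.monomial_one_right_eq_X_pow]
    change skewOperator σ hθ (SkewPolynomial.monomial N 1) x - x = 0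
    rw [skewOperator_monomial, hσ, map_one, map_one, one_mul, sub_self]
  have h := hker (TwoSidedIdeal.rel_iff _ _ _ |>.1 hrel)
  rw [TwoSidedIdeal.mem_ker, map_sub, sub_eq_zero, map_mul] at h
  have h2 := DFunLike.congr_fun h (γ : L)
  have h3 : skewOperator σ hθ f γ = 0 := by
    rw [← skewEval_mapSkew_mul, show skewEval (mapSkew (algebraMap F L) σ f) (σ γ * (γ : L)⁻¹) = 0 from hγ,
      zero_mul]
  change skewOperator σ hθ q (skewOperator σ hθ f γ) = _ at h2
  rw [h3, map_zero, skewOperator_sum] at h2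
  simpa [skewOperator_monomial] using h2.symm

theorem sum_mul_pow_eq_zero {ℓ : ℕ} {C : Submodule F (Fin ℓ → F)} {f : Polynomial F}
    (hf : IsCyclicGenerator C f) {u : Fin ℓ → F} (hu : u ∈ C) {α : L}
    (hα : α ∈ cyclicDefiningSet L ℓ f) : ∑ i, algebraMap F L (u i) * α ^ (i : ℕ) = 0 := by
  have hmem : muH u ∈ Ideal.span {(Ideal.Quotient.mk _ f : CyclicRing F ℓ)} :=
    hf.subset ⟨u, hu, rfl⟩
  obtain ⟨q, hq⟩ := Ideal.mem_span_singleton'.1 hmem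
  obtain ⟨q, rfl⟩ := Ideal.Quotient.mk_surjective q
  rw [← map_mul, muH, Ideal.Quotient.eq, Ideal.mem_span_singleton'] at hq
  obtain ⟨p, hp⟩ := hq
  have h := congrArg (Polynomial.aeval α) hp
  simpa [hα.1, hα.2, Polynomial.aeval_monomial, eq_comm] using h

end SkewOperator

end
end HTProduct

namespace HTProduct

/-! ### Independence, the twisted sequence and its rank bound -/

section Main

/-- Elements of a Galois extension that are independent over the base remain independent as
functions on the Galois group. -/
theorem eq_zero_of_sum_mul_galois_eq_zero {K L : Type*} [Field K] [Field L] [Algebra K L]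
    [FiniteDimensional K L] [IsGalois K L] {ι : Type*} [Fintype ι] {y : ι → L}
    (hy : LinearIndependent K y) {X : ι → L}
    (hX : ∀ τ : L ≃ₐ[K] L, ∑ k, X k * τ (y k) = 0) : X = 0 := by
  have h1 : ∀ τ : L ≃ₐ[K] L, ∑ k, τ (X k) * y k = 0 := fun τ => by
    have := congrArg τ (hX τ.symm)
    simpa using this
  -- Weighting the relations `h1` by τ(c) and summing over τ gives a relation among the `y k` whose
  -- coefficients are traces, so lie in K.
  have h2 : ∀ c : L, ∀ k, Algebra.trace K L (c * X k) = 0 := fun c => by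
    refine Fintype.linearIndependent_iff.1 hy _ ?_
    simp only [Algebra.smul_def, trace_eq_sum_automorphisms, map_mul, Finset.sum_mul]
    rw [Finset.sum_comm]
    refine Finset.sum_eq_zero fun τ _ => ?_
    simp only [mul_assoc]
    rw [← Finset.mul_sum, h1, mul_zero]
  funext k
  exact (traceForm_nondegenerate K L).1 (X k) fun c => by
    rw [Algebra.traceForm_apply, mul_comm]; exact h2 c k

/-- A vector `v` of rank weight `w` factors as `v = x A` with `x ∈ F ^ w` having nonzero entries
and `A` a `w × N` matrix over `E` with a right inverse `B`. -/
theorem exists_rank_factorization (E : Type*) {F : Type*} [Field E] [Field F] [Algebra E F]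
    {N : ℕ} (v : Fin N → F) :
    ∃ (x : Fin (rankWeight E v) → F) (A : Fin (rankWeight E v) → Fin N → E)
      (B : Fin N → Fin (rankWeight E v) → E), (∀ k, x k ≠ 0) ∧
      (∀ j, v j = ∑ k, A k j • x k) ∧
      ∀ k k', ∑ j, A k j * B j k' = if k = k' then 1 else 0 := by
  have : FiniteDimensional E (Submodule.span E (Set.range v)) :=
    FiniteDimensional.span_of_finite E (Set.finite_range v)
  let e : Module.Basis (Fin (rankWeight E v)) E (Submodule.span E (Set.range v)) :=
    Module.finBasis E _
  let w : Fin N → Submodule.span E (Set.range v) :=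
    fun j => ⟨v j, Submodule.subset_span ⟨j, rfl⟩⟩
  have hB : ∀ k, ∃ c : Fin N → E, ∑ j, c j • v j = (e k : F) := fun k =>
    (Submodule.mem_span_range_iff_exists_fun E).1 (e k).2
  choose c hc using hB
  refine ⟨fun k => e k, fun k j => e.repr (w j) k, fun j k => c k j,
    fun k h => e.ne_zero k (Subtype.ext h), fun j => ?_, fun k k' => ?_⟩
  · have h := congrArg (Submodule.subtype _) (e.sum_repr (w j))
    rw [map_sum] at h
    simp only [map_smul, Submodule.subtype_apply] at h
    exact h.symm
  · have h : ∑ j, c k' j • w j = e k' := Subtype.ext (by simpa [w] using hc k')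
    have h2 := DFunLike.congr_fun (congrArg e.repr h) k
    simpa [Finsupp.single_apply, mul_comm, eq_comm] using h2

/-- The right inverse `B` keeps the rows of `A` independent after extending scalars from E to K. -/
theorem linearIndependent_sum_smul {E K L : Type*} [Field E] [Field K] [Field L] [Algebra E K]
    [Algebra E L] [Algebra K L] [IsScalarTower E K L] {ι κ : Type*} [Fintype ι] [Fintype κ]
    [DecidableEq κ] {A : κ → ι → E} {B : ι → κ → E}
    (hAB : ∀ k k', ∑ j, A k j * B j k' = if k = k' then 1 else 0) {y : ι → L}
    (hy : LinearIndependent K y) : LinearIndependent K fun k => ∑ j, A k j • y j := by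
  rw [Fintype.linearIndependent_iff]
  intro g hg k'
  have h : ∀ j, ∑ k, g k * algebraMap E K (A k j) = 0 := by
    refine Fintype.linearIndependent_iff.1 hy _ ?_
    rw [← hg]
    simp only [Finset.smul_sum, Finset.sum_smul]
    rw [Finset.sum_comm]
    refine Finset.sum_congr rfl fun k _ => Finset.sum_congr rfl fun j _ => ?_
    rw [mul_smul, algebraMap_smul]
  calc g k' = ∑ k, g k * algebraMap E K (∑ j, A k j * B j k') := by simp [hAB]
    _ = ∑ j, (∑ k, g k * algebraMap E K (A k j)) * algebraMap E K (B j k') := by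
      simp only [map_sum, map_mul, Finset.mul_sum, Finset.sum_mul]
      rw [Finset.sum_comm]
      simp only [mul_assoc]
    _ = 0 := by simp [h]

variable {K L : Type*} [Field K] [Field L] [Algebra K L] {ι κ : Type*}

/-- The sequence `n ↦ (c_i ^ n σ ^ n(y_k))_{i, k}`. -/
def twistedSequence (σ : L ≃ₐ[K] L) (c : ι → K) (y : κ → L) (n : ℤ) : ι × κ → L :=
  fun p => algebraMap K L (c p.1 ^ n) * (σ ^ n) (y p.2)

/-- The map z ↦ (c_i^t σ^t(z_{i,k})) is σ^t-semilinear and, as σ fixes the c_i, takes the term at n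
to the term at n + t. -/
theorem isShiftStable_twistedSequence (σ : L ≃ₐ[K] L) {c : ι → K} (hc : ∀ i, c i ≠ 0)
    (y : κ → L) : IsShiftStable L (twistedSequence σ c y) := by
  intro A n t h
  have key : ∀ z ∈ Submodule.span L (twistedSequence σ c y '' A),
      (fun p : ι × κ => algebraMap K L (c p.1 ^ t) * (σ ^ t) (z p)) ∈
        Submodule.span L (twistedSequence σ c y '' ((· + t) '' A)) := by
    intro z hz
    induction hz using Submodule.span_induction with
    | mem z hz =>
      obtain ⟨n, hn, rfl⟩ := hz
      refine Submodule.subset_span ⟨n + t, ⟨n, hn, rfl⟩, ?_⟩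
      funext p
      simp only [twistedSequence, map_mul, AlgEquiv.commutes]
      rw [← mul_assoc, ← map_mul, ← zpow_add₀ (hc _), ← AlgEquiv.mul_apply, ← zpow_add,
        add_comm t]
    | zero =>
      convert Submodule.zero_mem (Submodule.span L (twistedSequence σ c y '' ((· + t) '' A)))
        using 1
      funext p
      simp
    | add z z' _ _ h h' =>
      convert Submodule.add_mem _ h h' using 1
      funext p
      simp [mul_add]
    | smul a z _ h =>
      convert Submodule.smul_mem _ ((σ ^ t) a) h using 1
      funext p
      simp [mul_left_comm]
  convert key _ h using 1
  funext p
  simp only [twistedSequence, map_mul, AlgEquiv.commutes]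
  rw [← mul_assoc, ← map_mul, ← zpow_add₀ (hc _), ← AlgEquiv.mul_apply, ← zpow_add, add_comm t]

theorem twistedSequence_periodic {σ : L ≃ₐ[K] L} {c : ι → K} {y : κ → L} {N : ℕ}
    (hσ : σ ^ N = 1) (hc : ∀ i, c i ^ N = 1) {n n' : ℤ} (h : (N : ℤ) ∣ n' - n) :
    twistedSequence σ c y n = twistedSequence σ c y n' := by
  obtain ⟨q, hq⟩ := h
  obtain rfl : n' = n + N * q := by linarith
  funext p
  have hc0 : c p.1 ^ (n + N * q) = c p.1 ^ n := by
    rcases eq_or_ne (N : ℤ) 0 with h0 | h0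
    · simp [h0]
    · have : c p.1 ≠ 0 := fun h => by
        have := hc p.1
        rw [h, zero_pow (by exact_mod_cast h0)] at this
        exact zero_ne_one this
      rw [zpow_add₀ this, zpow_mul, zpow_natCast, hc, one_zpow, mul_one]
  have hσ0 : σ ^ (n + N * q) = σ ^ n := by
    rw [zpow_add, zpow_mul, zpow_natCast, hσ, one_zpow, mul_one]
  simp [twistedSequence, hc0, hσ0]

/-- If `ℓ` is coprime to the order of the cyclic group `⟨σ⟩ = Gal(L / K)`, the sequence attached
to distinct `ℓ`-th roots of unity and independent elements spans. -/
theorem span_range_twistedSequence [FiniteDimensional K L] [IsGalois K L] [Fintype ι] [Fintype κ]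
    {σ : L ≃ₐ[K] L} (hσ : ∀ τ, τ ∈ Subgroup.zpowers σ) {c : ι → K} (hc : Function.Injective c)
    {ℓ m : ℕ} (hℓm : ℓ.Coprime m) (hσm : σ ^ m = 1) (hcℓ : ∀ i, c i ^ ℓ = 1)
    (hm : m ≠ 0) {y : κ → L} (hy : LinearIndependent K y) :
    Submodule.span L (Set.range (twistedSequence σ c y)) = ⊤ := by
  classical
  by_contra hne
  obtain ⟨f, hf0, hf⟩ := Submodule.exists_dual_map_eq_bot_of_lt_top (lt_top_iff_ne_top.2 hne)
    inferInstance
  have hfφ : ∀ n, f (twistedSequence σ c y n) = 0 := fun n => by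
    have : f (twistedSequence σ c y n) ∈ Submodule.map f
        (Submodule.span L (Set.range (twistedSequence σ c y))) :=
      Submodule.mem_map_of_mem (Submodule.subset_span ⟨n, rfl⟩)
    rw [hf] at this
    exact (Submodule.mem_bot L).1 this
  have hsum : ∀ z : ι × κ → L, f z = ∑ i, ∑ k, z (i, k) * f (Pi.single (i, k) 1) := fun z => by
    conv_lhs => rw [← Finset.univ_sum_single z]
    rw [map_sum, Fintype.sum_prod_type]
    refine Finset.sum_congr rfl fun i _ => Finset.sum_congr rfl fun k _ => ?_
    rw [← smul_eq_mul, ← map_smul, ← Pi.single_smul, smul_eq_mul, mul_one]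
  -- By coprimality of `ℓ` and `m`, the power of `c i` and the automorphism can be prescribed
  -- independently through a single exponent n.
  have hcrt : ∀ (p : ℕ) (τ : L ≃ₐ[K] L),
      ∑ i, (∑ k, f (Pi.single (i, k) 1) * τ (y k)) * algebraMap K L (c i) ^ p = 0 := by
    intro p τ
    obtain ⟨q, rfl⟩ := hσ τ
    obtain ⟨s, hs⟩ := Int.eq_ofNat_of_zero_le
      (Int.emod_nonneg q (Int.natCast_ne_zero.2 hm))
    obtain ⟨n, hn1, hn2⟩ := Nat.chineseRemainder hℓm p s
    have h := hfφ n
    rw [hsum] at h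
    rw [← h]
    refine Finset.sum_congr rfl fun i _ => ?_
    rw [Finset.sum_mul]
    refine Finset.sum_congr rfl fun k _ => ?_
    have e1 : c i ^ n = c i ^ p := pow_eq_pow_of_modEq hn1 (hcℓ i)
    have e2 : σ ^ (n : ℤ) = σ ^ q := by
      rw [zpow_natCast, pow_eq_pow_of_modEq hn2 hσm, ← Int.emod_add_mul_ediv q m, hs, zpow_add,
        zpow_mul, zpow_natCast, zpow_natCast, hσm, one_zpow, mul_one]
    simp only [twistedSequence, zpow_natCast, e1, ← e2, map_pow]
    ring
  have hzero : ∀ (τ : L ≃ₐ[K] L) (i : ι), ∑ k, f (Pi.single (i, k) 1) * τ (y k) = 0 := by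
    intro τ
    let e := Fintype.equivFin ι
    -- For fixed τ this is a Vandermonde system with distinct nodes `c i`.
    have := Matrix.eq_zero_of_forall_pow_sum_mul_pow_eq_zero
      (f := fun j => algebraMap K L (c (e.symm j)))
      (v := fun j => ∑ k, f (Pi.single (e.symm j, k) 1) * τ (y k))
      (((algebraMap K L).injective.comp hc).comp e.symm.injective) fun p => by
        rw [← hcrt p τ]
        exact Equiv.sum_comp e.symm
          fun i => (∑ k, f (Pi.single (i, k) 1) * τ (y k)) * algebraMap K L (c i) ^ (p : ℕ)
    intro i
    simpa using congrFun this (e i)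
  refine hf0 (LinearMap.ext fun z => ?_)
  rw [hsum]
  refine Finset.sum_eq_zero fun i _ => Finset.sum_eq_zero fun k _ => ?_
  rw [congrFun (eq_zero_of_sum_mul_galois_eq_zero hy
    (X := fun k => f (Pi.single (i, k) 1)) fun τ => hzero τ i) k]
  simp

/-- The Hartmann–Tzeng bound for a nontrivial relation between the coordinates of
`twistedSequence`. -/
theorem add_le_card_mul_card [FiniteDimensional K L] [IsGalois K L] [Fintype ι] [Fintype κ]
    {σ : L ≃ₐ[K] L} (hσ : ∀ τ, τ ∈ Subgroup.zpowers σ) {c : ι → K} (hc : Function.Injective c)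
    {ℓ m : ℕ} (hℓm : ℓ.Coprime m) (hσm : σ ^ m = 1) (hcℓ : ∀ i, c i ^ ℓ = 1)
    (hℓ : 0 < ℓ) (hm : 0 < m) {y : κ → L} (hy : LinearIndependent K y)
    {t₁ t₂ : ℤ} {d r : ℕ} (ht₁ : Int.gcd ((ℓ * m : ℕ) : ℤ) t₁ = 1)
    (ht₂ : Int.gcd ((ℓ * m : ℕ) : ℤ) t₂ < d + 2) {X : ι × κ → L} (hX : X ≠ 0)
    (h : ∀ n ∈ progression (progression {0} t₁ d) t₂ r,
      ∑ p, X p * twistedSequence σ c y n p = 0) :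
    d + 2 + r ≤ Fintype.card ι * Fintype.card κ := by
  classical
  have hc0 : ∀ i, c i ≠ 0 := fun i h => by
    have := hcℓ i
    rw [h, zero_pow hℓ.ne'] at this
    exact zero_ne_one this
  have hb := min_le_finrank_span_hartmannTzeng (isShiftStable_twistedSequence σ hc0 y)
    (span_range_twistedSequence hσ hc hℓm hσm hcℓ hm.ne' hy) (Nat.mul_pos hℓ hm)
    (fun n n' => twistedSequence_periodic (by rw [mul_comm, pow_mul, hσm, one_pow])
      fun i => by rw [pow_mul, hcℓ, one_pow]) ht₁ ht₂ (r := r)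
  rw [Module.finrank_fintype_fun_eq_card, Fintype.card_prod] at hb
  -- Otherwise the minimum in `hb` is the full dimension, and the form with coefficients `X`
  -- vanishes identically. The properness of the span raises d + 1 + r to d + 2 + r.
  by_contra hlt
  have htop : Submodule.span L
      (twistedSequence σ c y '' progression (progression {0} t₁ d) t₂ r) = ⊤ := by
    refine Submodule.eq_top_of_finrank_eq (le_antisymm (Submodule.finrank_le _) ?_)
    rw [Module.finrank_fintype_fun_eq_card, Fintype.card_prod]
    omega
  let f : (ι × κ → L) →ₗ[L] L := ∑ p, X p • LinearMap.proj p
  have hf : ∀ z, f z = ∑ p, X p * z p := fun z => by simp [f, LinearMap.sum_apply]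
  have hker : (⊤ : Submodule L (ι × κ → L)) ≤ LinearMap.ker f := by
    rw [← htop, Submodule.span_le]
    rintro _ ⟨n, hn, rfl⟩
    exact (hf _).trans (h n hn)
  refine hX (funext fun p => ?_)
  have : f (Pi.single p 1) = 0 := hker Submodule.mem_top
  rw [hf] at this
  simpa [Pi.single_apply] using this

end Main

end HTProduct

/-! ### The product bound -/

theorem theorem6p3
    -- the fields `E ⊆ F, K ⊆ L = FK` with `F ∩ K = E`
    {E L : Type*} [Field E] [Field L] [Algebra E L]
    (F K : IntermediateField E L) [DecidableEq F]
    [FiniteDimensional E F] [FiniteDimensional E K]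
    (hFK : F ⊓ K = ⊥) (hL : F ⊔ K = ⊤)
    (m : ℕ) (hm : Module.finrank E F = m)
    -- `L / K` is cyclic Galois of degree `m`, and `θ` is the restriction of `σ` to `F`
    [IsGalois K L] [IsCyclic (L ≃ₐ[K] L)] (hLK : Module.finrank K L = m)
    (σ : L ≃ₐ[K] L) (θ : F ≃ₐ[E] F) (hθ : ∀ x : F, ((θ x : F) : L) = σ (x : L))
    (hθm : orderOf θ = m) (hθE : IntermediateField.fixedField (Subgroup.zpowers θ) = ⊥)
    (ℓ : ℕ) (hℓ : 0 < ℓ) (hℓm : ℓ.Coprime m)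
    -- the cyclic code, with a generator polynomial in `E[x]`
    (C₁ : Submodule F (Fin ℓ → F)) (hC₁ : HTProduct.IsCyclicCode C₁)
    (f₁ : Polynomial F) (hf₁ : HTProduct.IsCyclicGenerator C₁ f₁)
    (hf₁E : f₁ ∈ Polynomial.lifts (algebraMap E F))
    (dH : ℕ) (hdH : HTProduct.IsMinHammingDist C₁ dH)
    -- the skew-cyclic code
    (C₂ : Submodule F (Fin m → F)) (hC₂ : HTProduct.IsSkewCyclicCode (θ : F →+* F) C₂)
    (f₂ : HTProduct.SkewPoly (θ : F →+* F))
    (hf₂ : HTProduct.IsSkewCyclicGenerator (θ : F →+* F) C₂ f₂)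
    (dR : ℕ) (hdR : HTProduct.IsMinRankDist E C₂ dR)
    -- the parameters
    (b δ r t₁ t₂ : ℤ) (hr : 0 ≤ r)
    (ht₁ : Int.gcd ((ℓ * m : ℕ) : ℤ) t₁ = 1)
    (ht₂ : (Int.gcd ((ℓ * m : ℕ) : ℤ) t₂ : ℤ) < δ)
    (a : K) (ha : IsPrimitiveRoot a ℓ)
    (β : Lˣ) (hβ : HTProduct.IsNormalElement K (β : L))
    (hT : {p : L × Lˣ | ∃ i s : ℤ, 0 ≤ i ∧ i ≤ δ - 2 ∧ 0 ≤ s ∧ s ≤ r ∧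
        p = (((a ^ (b + i * t₁ + s * t₂) : K) : L), (σ ^ (i * t₁ + s * t₂)) • β)} ⊆
      HTProduct.uplus (HTProduct.cyclicDefiningSet L ℓ f₁)
        (HTProduct.skewCyclicDefiningSet (σ : L →+* L) f₂)) :
    ⌈((δ + r : ℤ) : ℚ) / (dR : ℚ)⌉ ≤ (dH : ℤ) ∧
      ⌈((δ + r : ℤ) : ℚ) / (dH : ℚ)⌉ ≤ (dR : ℤ) := by
  classical
  have hm0 : 0 < m := hm ▸ Module.finrank_pos
  have : FiniteDimensional K L := FiniteDimensional.of_finrank_pos (hLK ▸ hm0)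
  have hθpow : ∀ (j : ℕ) (x : F), (((θ ^ j) x : F) : L) = (σ ^ j) (x : L) := by
    intro j
    induction j with
    | zero => simp
    | succ j ih =>
      intro x
      rw [pow_succ, pow_succ, AlgEquiv.mul_apply, AlgEquiv.mul_apply, ih, hθ]
  have hcard : Nat.card (L ≃ₐ[K] L) = m := (IsGalois.card_aut_eq_finrank K L).trans hLK
  have hσm : σ ^ m = 1 := hcard ▸ pow_card_eq_one'
  have hσord : orderOf σ = m := by
    refine Nat.dvd_antisymm (orderOf_dvd_of_pow_eq_one hσm) ?_
    rw [← hθm]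
    refine orderOf_dvd_of_pow_eq_one (AlgEquiv.ext fun x => Subtype.ext ?_)
    rw [hθpow, pow_orderOf_eq_one]
    rfl
  have hσgen : ∀ τ, τ ∈ Subgroup.zpowers σ := fun τ => by
    rw [Subgroup.eq_top_of_card_eq (Subgroup.zpowers σ)
      (by rw [Nat.card_zpowers, hσord, hcard])]
    trivial
  obtain ⟨⟨u₁, hu₁, u₂, hu₂, hu, rfl⟩, -⟩ := hdH
  obtain ⟨⟨v₁, hv₁, v₂, hv₂, hv, rfl⟩, -⟩ := hdR
  rw [HTProduct.rankDist, hammingDist_comm, hammingDist_eq_hammingNorm, neg_add_eq_sub]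
  have huC := C₁.sub_mem hu₁ hu₂
  have hvC := C₂.sub_mem hv₁ hv₂
  replace hu := sub_ne_zero.2 hu
  replace hv := sub_ne_zero.2 hv
  generalize u₁ - u₂ = u at *
  generalize v₁ - v₂ = v at *
  -- Both ceilings follow from this one inequality on dividing by either weight.
  suffices h : δ + r ≤ (hammingNorm u : ℤ) * HTProduct.rankWeight E v by
    have hH : 0 < hammingNorm u := hammingNorm_pos_iff.2 hu
    have hR : 0 < HTProduct.rankWeight E v := by
      obtain ⟨x, A, B, -, hvx, -⟩ := HTProduct.exists_rank_factorization E v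
      rw [Nat.pos_iff_ne_zero]
      intro h0
      have : IsEmpty (Fin (HTProduct.rankWeight E v)) := by rw [h0]; infer_instance
      exact hv (funext fun j => by rw [hvx]; simp)
    constructor
    · rw [Int.ceil_le, div_le_iff₀ (by exact_mod_cast hR)]
      exact_mod_cast h
    · rw [Int.ceil_le, div_le_iff₀ (by exact_mod_cast hH), mul_comm]
      exact_mod_cast h
  obtain ⟨x, A, B, hx, hvx, hAB⟩ := HTProduct.exists_rank_factorization E v
  -- A positive gcd lies below δ, so truncating δ - 2 to a natural number loses nothing.
  have hδ : 2 ≤ δ := by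
    have : 0 < Int.gcd ((ℓ * m : ℕ) : ℤ) t₂ :=
      Int.gcd_pos_of_ne_zero_left _ (by exact_mod_cast (Nat.mul_pos hℓ hm0).ne')
    omega
  have ha0 : (a : K) ≠ 0 := ha.ne_zero hℓ.ne'
  have hβind : LinearIndependent K fun j : Fin m => (σ ^ (j : ℕ)) (β : L) :=
    hβ.1.comp (fun j : Fin m => σ ^ (j : ℕ)) fun i j hij =>
      Fin.ext (pow_injOn_Iio_orderOf (x := σ) (by simp [hσord]) (by simp [hσord]) hij)
  have hσiter : ∀ (j : ℕ) (z : L), (σ : L →+* L)^[j] z = (σ ^ j) z := by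
    intro j
    induction j with
    | zero => intro z; rfl
    | succ j ih =>
      intro z
      rw [Function.iterate_succ_apply, ih, pow_succ, AlgEquiv.mul_apply]
      rfl
  -- Indexing by the support of `u` makes the number of nodes its Hamming weight.
  let c : {i // u i ≠ 0} → K := fun i => a ^ (i.1 : ℕ)
  let y : Fin (HTProduct.rankWeight E v) → L := fun k => ∑ j, A k j • (σ ^ (j : ℕ)) (β : L)
  -- The offset `b` is absorbed into the coefficients, so the progression may start at 0.
  let X : {i // u i ≠ 0} × Fin (HTProduct.rankWeight E v) → L :=
    fun p => u p.1.1 * x p.2 * ((a : L) ^ b) ^ (p.1.1 : ℕ)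
  have haL : (a : L) ≠ 0 := by exact_mod_cast ha0
  obtain ⟨i₀, hi₀⟩ := Function.ne_iff.1 hu
  obtain ⟨j₀, hj₀⟩ := Function.ne_iff.1 hv
  have hX : X ≠ 0 := by
    have hk : Nonempty (Fin (HTProduct.rankWeight E v)) := by
      by_contra hk
      rw [not_nonempty_iff] at hk
      exact hj₀ (by rw [hvx]; simp)
    obtain ⟨k₀⟩ := hk
    refine Function.ne_iff.2 ⟨(⟨i₀, hi₀⟩, k₀), ?_⟩
    exact mul_ne_zero (mul_ne_zero (by exact_mod_cast hi₀) (by exact_mod_cast hx k₀))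
      (pow_ne_zero _ (zpow_ne_zero _ haL))
  have hbound := HTProduct.add_le_card_mul_card (d := (δ - 2).toNat) (r := r.toNat) hσgen
    (c := c) (fun i j hij => Subtype.ext (Fin.ext (ha.pow_inj i.1.2 j.1.2 hij))) hℓm hσm
    (fun i => by rw [← pow_mul, mul_comm, pow_mul, ha.pow_eq_one, one_pow]) hℓ hm0
    (y := y) (HTProduct.linearIndependent_sum_smul hAB hβind) ht₁ (t₂ := t₂) (by omega) hX (by
      rintro n ⟨_, ⟨_, rfl, i, hi, rfl⟩, s, hs, rfl⟩
      rw [zero_add]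
      have hmem := hT ⟨i, s, by omega, by omega, by omega, by omega, rfl⟩
      rw [add_assoc] at hmem
      generalize (i : ℤ) * t₁ + s * t₂ = n at *
      have hprod : (∑ i, algebraMap F L (u i) * (((a ^ (b + n) : K) : L)) ^ (i : ℕ)) *
          ∑ j, algebraMap F L (v j) * (σ : L →+* L)^[j] ((σ ^ n • β : Lˣ) : L) = 0 := by
        rcases hmem with h | h
        · rw [HTProduct.sum_mul_pow_eq_zero hf₁ huC h, zero_mul]
        · rw [HTProduct.sum_mul_iterate_eq_zero (fun z => hθ z)
            (fun z => by rw [hσiter, hσm]; rfl) hf₂ hvC h, mul_zero]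
      have hR : ∑ j, algebraMap F L (v j) * (σ : L →+* L)^[j] ((σ ^ n • β : Lˣ) : L) =
          ∑ k, (x k : L) * (σ ^ n) (y k) := by
        have hcoe : ((σ ^ n • β : Lˣ) : L) = (σ ^ n) (β : L) := rfl
        -- The entries of `A` lie in E, inside the field K fixed by σ, so they commute with all its
        -- powers.
        have hE : ∀ (e : E) (z : L), (σ ^ n) (e • z) = e • (σ ^ n) z := fun e z => by
          rw [← algebraMap_smul K e z, map_smul, algebraMap_smul]
        simp only [y, hcoe, hσiter, map_sum, hE, Finset.mul_sum]
        rw [Finset.sum_comm]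
        refine Finset.sum_congr rfl fun j _ => ?_
        rw [hvx j, map_sum, Finset.sum_mul]
        refine Finset.sum_congr rfl fun k _ => ?_
        rw [← AlgEquiv.mul_apply, ← AlgEquiv.mul_apply, ← zpow_natCast, ← zpow_add, ← zpow_add,
          add_comm n, mul_smul_comm]
        change (((A k j • x k : F) : L)) * _ = _
        rw [IntermediateField.coe_smul, smul_mul_assoc]
      have hH : ∑ i, algebraMap F L (u i) * (((a ^ (b + n) : K) : L)) ^ (i : ℕ) =
          ∑ i : {i // u i ≠ 0}, (u i.1 : L) * (((a ^ (b + n) : K) : L)) ^ (i.1 : ℕ) := by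
        rw [← Finset.sum_filter_of_ne (p := fun i => u i ≠ 0) fun i _ h h0 => h (by simp [h0])]
        exact Finset.sum_subtype _ (by simp) _
      rw [hR, hH, Finset.sum_mul_sum, ← Fintype.sum_prod_type'] at hprod
      rw [← hprod]
      refine Finset.sum_congr rfl fun p _ => ?_
      simp only [X, c, HTProduct.twistedSequence]
      have hpow : (((a ^ (b + n) : K) : L)) ^ (p.1.1 : ℕ) = ((a : L) ^ b) ^ (p.1.1 : ℕ) *
          algebraMap K L ((a ^ (p.1.1 : ℕ)) ^ n) := by
        have : ((a ^ (b + n) : K) : L) = (a : L) ^ b * (a : L) ^ n := by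
          rw [← zpow_add₀ haL]; rfl
        rw [this, mul_pow]
        congr 1
        rw [map_zpow₀, map_pow]
        change _ = ((a : L) ^ (p.1.1 : ℕ)) ^ n
        rw [← zpow_natCast, ← zpow_natCast, zpow_comm]
      rw [hpow]
      ring)
  rw [Fintype.card_subtype, Fintype.card_fin] at hbound
  have : (hammingNorm u : ℕ) = Finset.card {i | u i ≠ 0} := rfl
  rw [this]
  zify at hbound
  rw [Int.toNat_of_nonneg (by omega), Int.toNat_of_nonneg hr] at hbound
  linarith
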